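/- Let $n\ge 1$ and let $\Omega\subset\mathbb R^n$ be an open, bounded, strictly convex domain with smooth boundary and $0\in\Omega$. Let $\mathcal C_0$ be the set of functions $u\in C^\infty(\overline\Omega)$ with $D^2u$ positive definite in $\Omega$ and $u=0$ on $\partial\Omega$. For $u\in\mathcal C_0$ put $u^{\star}(x):=\langle x,\nabla u(x)\rangle-u(x)$, and let $\Omega^{\circ}:=\{x\in\mathbb R^n:\langle x,y\rangle\le 1\text{ for all }y\in\Omega\}$ be the polar body of $\Omega$, with Lebesgue measure $|\Omega^\circ|$. Theorem. We have $|\Omega^\circ|<\infty$, and for every $u\in\mathcal C_0$ the function $u^{\star}$ is positive in $\Omega$, the integral below converges absolutely, and \[\int_\Omega \frac{(-u)\,\det D^2u}{(u^{\star})^{n+1}}\,dx = |\Omega^{\circ}|.\] In particular, this integral does not depend on the choice of $u\in\mathcal C_0$. -/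

import Mathlib

open MeasureTheory
open scoped ContDiff

/-- `ℝⁿ` with its Euclidean norm, inner product and Lebesgue measure. -/
abbrev Euc (n : ℕ) : Type := EuclideanSpace ℝ (Fin n)

/-- The boundary of `Ω` is smooth: near each boundary point, `Ω` is the strict sublevel set of a
smooth function whose differential does not vanish at that point. -/
def HasSmoothBoundary {n : ℕ} (Ω : Set (Euc n)) : Prop :=
  ∀ p ∈ frontier Ω, ∃ (V : Set (Euc n)) (ρ : Euc n → ℝ),
    IsOpen V ∧ p ∈ V ∧ ContDiffOn ℝ ∞ ρ V ∧ fderiv ℝ ρ p ≠ 0 ∧ Ω ∩ V = {x ∈ V | ρ x < 0}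

/-- Open, bounded, smooth, strictly convex domains. Strict convexity is asked of the closure
(no segments in the boundary), since for an open set `StrictConvex` only means convex. -/
structure IsSmoothStrictlyConvexDomain {n : ℕ} (Ω : Set (Euc n)) : Prop where
  isOpen : IsOpen Ω
  isBounded : Bornology.IsBounded Ω
  convex : Convex ℝ Ω
  strictConvex_closure : StrictConvex ℝ (closure Ω)
  smoothBoundary : HasSmoothBoundary Ω

/-- The Hessian matrix `D²u(x)`, with entries `∂ᵢ∂ⱼu(x)`. -/
noncomputable def hessian {n : ℕ} (u : Euc n → ℝ) (x : Euc n) : Matrix (Fin n) (Fin n) ℝ :=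
  Matrix.of fun i j =>
    fderiv ℝ (fderiv ℝ u) x (EuclideanSpace.single i 1) (EuclideanSpace.single j 1)

/-- The class `𝒞₀` of functions `u ∈ C^∞(Ω̄)` with `D²u > 0` and `u = 0` on `∂Ω`. (Values of `u`
outside `Ω̄` are irrelevant.) -/
structure MemC0 {n : ℕ} (Ω : Set (Euc n)) (u : Euc n → ℝ) : Prop where
  smooth : ContDiffOn ℝ ∞ u (closure Ω)
  posDef : ∀ x ∈ Ω, (hessian u x).PosDef
  boundary : ∀ x ∈ frontier Ω, u x = 0

/-- `u⋆(x) = ⟨x, ∇u(x)⟩ - u(x)`. -/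
noncomputable def legendreStar {n : ℕ} (u : Euc n → ℝ) (x : Euc n) : ℝ :=
  inner ℝ x (gradient u x) - u x

/-- The polar body `Ω° = {x : ⟨x, y⟩ ≤ 1 for all y ∈ Ω}`. -/
def polarBody {n : ℕ} (Ω : Set (Euc n)) : Set (Euc n) :=
  {x | ∀ y ∈ Ω, inner ℝ x y ≤ 1}

/-- The integrand `(-u) det D²u / (u⋆)^{n+1}`. -/
noncomputable def polarIntegrand {n : ℕ} (u : Euc n → ℝ) (x : Euc n) : ℝ :=
  (-u x) * (hessian u x).det / (legendreStar u x) ^ (n + 1)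

/-! The integral is a change of variables along `polarMap u`, the map x ↦ ∇u(x)/u⋆(x). Its Jacobian
determinant is exactly the integrand (`det_fderivPolarMap`). Strict convexity makes it injective on
Ω (`MemC0.injOn_polarMap`), and its image lies between the interior of Ω° and Ω° itself
(`MemC0.inner_polarMap_lt_one`, `MemC0.interior_polarBody_subset`). The boundary of a convex set is
null, so the integral is |Ω°|, which is finite because Ω contains a ball about 0. -/

lemma euc_eq_sum_single {n : ℕ} (w : Euc n) :
    w = ∑ i, w i • EuclideanSpace.single i (1 : ℝ) := by
  ext j
  simp [Pi.single_apply]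

lemma fderiv_fderiv_self_pos {n : ℕ} {u : Euc n → ℝ} {x : Euc n} (h : (hessian u x).PosDef)
    {w : Euc n} (hw : w ≠ 0) : 0 < fderiv ℝ (fderiv ℝ u) x w w := by
  have hw' : (fun i => w i) ≠ 0 := fun h0 => hw (by ext i; exact congrFun h0 i)
  have key := h.dotProduct_mulVec_pos hw'
  have : fderiv ℝ (fderiv ℝ u) x w w
      = star (fun i => w i) ⬝ᵥ (hessian u x).mulVec (fun i => w i) := by
    conv_lhs => rw [euc_eq_sum_single w]
    simp only [map_sum, map_smul, sum_apply, smul_apply,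
      smul_eq_mul, dotProduct, Matrix.mulVec, hessian, Matrix.of_apply, Finset.mul_sum,
      Pi.star_apply, star_trivial]
    rw [Finset.sum_comm]
    refine Finset.sum_congr rfl fun i _ => Finset.sum_congr rfl fun j _ => by ring
  rwa [this]

section
variable {E : Type*} [NormedAddCommGroup E] [NormedSpace ℝ E]

/-- A function with positive definite second derivative on a convex open set lies strictly above
its tangent planes. -/
lemma add_fderiv_lt_of_fderiv_fderiv_pos {u : E → ℝ} {Ω : Set E}
    (hΩ : Convex ℝ Ω) (hd : ∀ x ∈ Ω, DifferentiableAt ℝ u x)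
    (hd2 : ∀ x ∈ Ω, DifferentiableAt ℝ (fderiv ℝ u) x)
    (hpos : ∀ x ∈ Ω, ∀ w ≠ 0, 0 < fderiv ℝ (fderiv ℝ u) x w w)
    {x y : E} (hx : x ∈ Ω) (hy : y ∈ Ω) (hxy : x ≠ y) :
    u x + fderiv ℝ u x (y - x) < u y := by
  set w := y - x with hw
  have hw0 : w ≠ 0 := sub_ne_zero.2 hxy.symm
  have hmem : ∀ t ∈ Set.Icc (0 : ℝ) 1, x + t • w ∈ Ω := fun t ht =>
    hΩ.add_smul_sub_mem hx hy ht
  have hline : ∀ t : ℝ, HasDerivAt (fun t : ℝ => x + t • w) w t := fun t => by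
    simpa using ((hasDerivAt_id t).smul_const w).const_add x
  have h1 : ∀ t ∈ Set.Icc (0 : ℝ) 1,
      HasDerivAt (fun t : ℝ => u (x + t • w)) (fderiv ℝ u (x + t • w) w) t := fun t ht =>
    (hd _ (hmem t ht)).hasFDerivAt.comp_hasDerivAt t (hline t)
  have h2 : ∀ t ∈ Set.Icc (0 : ℝ) 1,
      HasDerivAt (fun t : ℝ => fderiv ℝ u (x + t • w) w)
        (fderiv ℝ (fderiv ℝ u) (x + t • w) w w) t := fun t ht => by
    have h := (hd2 _ (hmem t ht)).hasFDerivAt.comp_hasDerivAt t (hline t)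
    simpa using h.clm_apply (hasDerivAt_const t w)
  have hmono : StrictMonoOn (fun t : ℝ => fderiv ℝ u (x + t • w) w) (Set.Icc 0 1) := by
    refine strictMonoOn_of_deriv_pos (convex_Icc 0 1)
      (fun t ht => (h2 t ht).continuousAt.continuousWithinAt) fun t ht => ?_
    have ht' := interior_subset ht
    rw [(h2 t ht').deriv]
    exact hpos _ (hmem t ht') w hw0
  obtain ⟨c, hc, hceq⟩ := exists_hasDerivAt_eq_slope (fun t : ℝ => u (x + t • w)) _ zero_lt_one
    (fun t ht => (h1 t ht).continuousAt.continuousWithinAt)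
    (fun t ht => h1 t (Set.Ioo_subset_Icc_self ht))
  have hlt := hmono (Set.left_mem_Icc.2 zero_le_one) (Set.Ioo_subset_Icc_self hc) hc.1
  have hyx : x + w = y := by simp [hw]
  simp only [zero_smul, add_zero, one_smul, hyx, sub_zero, div_one] at hceq hlt
  linarith

end

/-! ### Signs of u and u⋆, and the polar map -/

section
variable {n : ℕ} {Ω : Set (Euc n)} {u : Euc n → ℝ}

lemma legendreStar_eq (u : Euc n → ℝ) (x : Euc n) :
    legendreStar u x = fderiv ℝ u x x - u x := by
  rw [legendreStar, real_inner_comm, inner_gradient_left]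

lemma MemC0.contDiffAt (hu : MemC0 Ω u) (hΩ : IsSmoothStrictlyConvexDomain Ω) {x : Euc n}
    (hx : x ∈ Ω) : ContDiffAt ℝ ∞ u x :=
  hu.smooth.contDiffAt (Filter.mem_of_superset (hΩ.isOpen.mem_nhds hx) subset_closure)

lemma MemC0.differentiableAt (hu : MemC0 Ω u) (hΩ : IsSmoothStrictlyConvexDomain Ω) {x : Euc n}
    (hx : x ∈ Ω) : DifferentiableAt ℝ u x :=
  (hu.contDiffAt hΩ hx).differentiableAt (by simp)

lemma MemC0.differentiableAt_fderiv (hu : MemC0 Ω u) (hΩ : IsSmoothStrictlyConvexDomain Ω)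
    {x : Euc n} (hx : x ∈ Ω) : DifferentiableAt ℝ (fderiv ℝ u) x :=
  ((hu.contDiffAt hΩ hx).fderiv_right (m := 1) (by norm_cast)).differentiableAt
    (by simp)

lemma MemC0.add_fderiv_lt (hu : MemC0 Ω u) (hΩ : IsSmoothStrictlyConvexDomain Ω) {x y : Euc n}
    (hx : x ∈ Ω) (hy : y ∈ Ω) (hxy : x ≠ y) : u x + fderiv ℝ u x (y - x) < u y :=
  add_fderiv_lt_of_fderiv_fderiv_pos hΩ.convex (fun _ h => hu.differentiableAt hΩ h)
    (fun _ h => hu.differentiableAt_fderiv hΩ h)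
    (fun _ h _ hw => fderiv_fderiv_self_pos (hu.posDef _ h) hw) hx hy hxy

lemma MemC0.fderiv_sub_lt_legendreStar (hu : MemC0 Ω u) (hΩ : IsSmoothStrictlyConvexDomain Ω)
    {x y : Euc n} (hx : x ∈ Ω) (hy : y ∈ Ω) (hxy : x ≠ y) :
    fderiv ℝ u x y - u y < legendreStar u x := by
  have h := hu.add_fderiv_lt hΩ hx hy hxy
  rw [map_sub] at h
  rw [legendreStar_eq]
  linarith

lemma MemC0.fderiv_sub_le_legendreStar (hu : MemC0 Ω u) (hΩ : IsSmoothStrictlyConvexDomain Ω)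
    {x y : Euc n} (hx : x ∈ Ω) (hy : y ∈ Ω) : fderiv ℝ u x y - u y ≤ legendreStar u x := by
  rcases eq_or_ne x y with rfl | hxy
  · exact (legendreStar_eq u x).ge
  · exact (hu.fderiv_sub_lt_legendreStar hΩ hx hy hxy).le

lemma IsSmoothStrictlyConvexDomain.isCompact_closure (hΩ : IsSmoothStrictlyConvexDomain Ω) :
    IsCompact (closure Ω) :=
  hΩ.isBounded.isCompact_closure

lemma IsSmoothStrictlyConvexDomain.mem_or_mem_frontier (hΩ : IsSmoothStrictlyConvexDomain Ω)
    {x : Euc n} (hx : x ∈ closure Ω) : x ∈ Ω ∨ x ∈ frontier Ω := by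
  rw [hΩ.isOpen.frontier_eq]
  by_cases h : x ∈ Ω
  · exact Or.inl h
  · exact Or.inr ⟨hx, h⟩

lemma MemC0.not_isMaxOn (hn : 1 ≤ n) (hu : MemC0 Ω u) (hΩ : IsSmoothStrictlyConvexDomain Ω)
    {x : Euc n} (hx : x ∈ Ω) : ¬ IsMaxOn u Ω x := by
  intro hmax
  have : Nonempty (Fin n) := ⟨⟨0, hn⟩⟩
  have hf : fderiv ℝ u x = 0 := (hmax.isLocalMax (hΩ.isOpen.mem_nhds hx)).fderiv_eq_zero
  obtain ⟨y, hy, hyx⟩ := (infinite_of_mem_nhds x (hΩ.isOpen.mem_nhds hx)).exists_notMem_finite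
    (Set.finite_singleton x)
  have h := hu.add_fderiv_lt hΩ hx hy (Ne.symm hyx)
  have h' : u y ≤ u x := hmax hy
  simp only [hf, zero_apply, add_zero] at h
  linarith

/-- Strict convexity excludes interior maxima, so the maximum over the closure is the boundary value
0; an interior zero would again be a maximum. -/
lemma MemC0.neg (hn : 1 ≤ n) (hu : MemC0 Ω u) (hΩ : IsSmoothStrictlyConvexDomain Ω)
    {x : Euc n} (hx : x ∈ Ω) : u x < 0 := by
  obtain ⟨z, hz, hmax⟩ := hΩ.isCompact_closure.exists_isMaxOn ⟨x, subset_closure hx⟩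
    hu.smooth.continuousOn
  have hmax' : ∀ y ∈ Ω, u y ≤ u z := fun y hy => hmax (subset_closure hy)
  rcases hΩ.mem_or_mem_frontier hz with h | h
  · exact absurd hmax' (hu.not_isMaxOn hn hΩ h)
  · rw [hu.boundary z h] at hmax'
    refine (hmax' x hx).lt_of_ne fun h0 => hu.not_isMaxOn hn hΩ hx fun y hy => ?_
    exact (hmax' y hy).trans h0.ge

lemma MemC0.legendreStar_pos (hn : 1 ≤ n) (hu : MemC0 Ω u) (hΩ : IsSmoothStrictlyConvexDomain Ω)
    (h0 : (0 : Euc n) ∈ Ω) {x : Euc n} (hx : x ∈ Ω) : 0 < legendreStar u x := by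
  have h1 := hu.fderiv_sub_le_legendreStar hΩ hx h0
  have h2 := hu.neg hn hΩ h0
  rw [map_zero] at h1
  linarith

/-- The map `x ↦ ∇u(x) / u⋆(x)`, sending `x` to the polar dual of the hyperplane in which the
tangent plane of the graph of `u` over `x` meets `ℝⁿ`. -/
noncomputable def polarMap (u : Euc n → ℝ) (x : Euc n) : Euc n :=
  (legendreStar u x)⁻¹ • gradient u x

lemma inner_polarMap (u : Euc n → ℝ) (x y : Euc n) :
    inner ℝ (polarMap u x) y = (legendreStar u x)⁻¹ * fderiv ℝ u x y := by
  rw [polarMap, real_inner_smul_left, inner_gradient_left]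

lemma MemC0.fderiv_eq_inner_polarMap (hn : 1 ≤ n) (hu : MemC0 Ω u)
    (hΩ : IsSmoothStrictlyConvexDomain Ω) (h0 : (0 : Euc n) ∈ Ω) {x : Euc n} (hx : x ∈ Ω)
    (y : Euc n) : fderiv ℝ u x y = legendreStar u x * inner ℝ (polarMap u x) y := by
  rw [inner_polarMap, mul_inv_cancel_left₀ (hu.legendreStar_pos hn hΩ h0 hx).ne']

lemma MemC0.inner_polarMap_lt_one (hn : 1 ≤ n) (hu : MemC0 Ω u)
    (hΩ : IsSmoothStrictlyConvexDomain Ω) (h0 : (0 : Euc n) ∈ Ω) {x y : Euc n} (hx : x ∈ Ω)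
    (hy : y ∈ Ω) : inner ℝ (polarMap u x) y < 1 := by
  have h1 := hu.fderiv_sub_le_legendreStar hΩ hx hy
  have h2 := hu.neg hn hΩ hy
  have h3 := hu.legendreStar_pos hn hΩ h0 hx
  rw [inner_polarMap, inv_mul_lt_one₀ h3]
  linarith

lemma MemC0.injOn_polarMap (hn : 1 ≤ n) (hu : MemC0 Ω u)
    (hΩ : IsSmoothStrictlyConvexDomain Ω) (h0 : (0 : Euc n) ∈ Ω) :
    Set.InjOn (polarMap u) Ω := by
  have key : ∀ x ∈ Ω, ∀ y ∈ Ω, polarMap u x = polarMap u y → x ≠ y →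
      legendreStar u y < legendreStar u x := by
    intro x hx y hy h hxy
    have h1 := hu.fderiv_sub_lt_legendreStar hΩ hx hy hxy
    have h2 := legendreStar_eq u y
    have h3 := hu.inner_polarMap_lt_one hn hΩ h0 hy hy
    rw [hu.fderiv_eq_inner_polarMap hn hΩ h0 hx, h] at h1
    rw [hu.fderiv_eq_inner_polarMap hn hΩ h0 hy] at h2
    -- Subtracting `h2` from `h1` gives (u⋆(x) - u⋆(y)) (1 - ⟨ξ, y⟩) > 0 with ξ the common image,
    -- and the second factor is positive by `h3`.
    by_contra! h4
    nlinarith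
  intro x hx y hy h
  by_contra hxy
  exact lt_asymm (key x hx y hy h hxy) (key y hy x hx h.symm (Ne.symm hxy))

lemma inner_lt_one_of_mem_interior_polarBody {ξ y : Euc n} (hξ : ξ ∈ interior (polarBody Ω))
    (hy : y ∈ closure Ω) : inner ℝ ξ y < 1 := by
  -- Some dilate tξ with t > 1 is still in the polar body, which leaves room for strictness even on
  -- ∂Ω.
  have hc : Filter.Tendsto (fun t : ℝ => t • ξ) (nhdsWithin 1 (Set.Ioi 1)) (nhds ξ) := by
    have : Continuous (fun t : ℝ => t • ξ) := by fun_prop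
    simpa using (this.tendsto 1).mono_left nhdsWithin_le_nhds
  obtain ⟨t, ht, ht1⟩ := ((hc.eventually (mem_interior_iff_mem_nhds.1 hξ)).and
    self_mem_nhdsWithin).exists
  have hle : inner ℝ (t • ξ) y ≤ 1 :=
    closure_minimal (s := Ω) (t := {y | inner ℝ (t • ξ) y ≤ 1}) ht
      (isClosed_le (by fun_prop) continuous_const) hy
  rw [real_inner_smul_left] at hle
  have ht1' : (1 : ℝ) < t := ht1
  by_contra! h
  nlinarith

/-- Among the affine functions t(⟨ξ, ·⟩ - 1), which vanish on the hyperplane dual to ξ, the one with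
t the maximum of -u/(1 - ⟨ξ, ·⟩) touches the graph of u from below. At the contact point ∇u = tξ and
u⋆ = t. -/
lemma MemC0.interior_polarBody_subset (hn : 1 ≤ n) (hu : MemC0 Ω u)
    (hΩ : IsSmoothStrictlyConvexDomain Ω) (h0 : (0 : Euc n) ∈ Ω) :
    interior (polarBody Ω) ⊆ polarMap u '' Ω := by
  intro ξ hξ
  have hlt : ∀ y ∈ closure Ω, 0 < 1 - inner ℝ ξ y := fun y hy =>
    sub_pos.2 (inner_lt_one_of_mem_interior_polarBody hξ hy)
  obtain ⟨x, hx, hmax⟩ := hΩ.isCompact_closure.exists_isMaxOn ⟨0, subset_closure h0⟩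
    (f := fun y => -u y / (1 - inner ℝ ξ y))
    (hu.smooth.continuousOn.neg.div (by fun_prop) fun y hy => (hlt y hy).ne')
  set t := -u x / (1 - inner ℝ ξ x) with ht
  have hmax' : ∀ y ∈ closure Ω, -u y / (1 - inner ℝ ξ y) ≤ t := fun y hy => hmax hy
  have htpos : 0 < t :=
    (div_pos (neg_pos.2 (hu.neg hn hΩ h0)) (hlt 0 (subset_closure h0))).trans_le
      (hmax' 0 (subset_closure h0))
  have hxΩ : x ∈ Ω := (hΩ.mem_or_mem_frontier hx).resolve_right fun h => by
    rw [ht, hu.boundary x h, neg_zero, zero_div] at htpos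
    exact htpos.false
  have hux : -u x = t * (1 - inner ℝ ξ x) := by
    rw [ht, div_mul_cancel₀ _ (hlt x hx).ne']
  have hmin : IsLocalMin (fun y => u y - t * inner ℝ ξ y) x := by
    filter_upwards [hΩ.isOpen.mem_nhds hxΩ] with y hy
    have h := (div_le_iff₀ (hlt y (subset_closure hy))).1 (hmax' y (subset_closure hy))
    linarith
  have hd : HasFDerivAt (fun y => u y - t * inner ℝ ξ y)
      (fderiv ℝ u x - t • innerSL ℝ ξ) x :=
    (hu.differentiableAt hΩ hxΩ).hasFDerivAt.sub ((innerSL ℝ ξ).hasFDerivAt.const_mul t)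
  have hdu : fderiv ℝ u x = t • innerSL ℝ ξ := sub_eq_zero.1 (hmin.hasFDerivAt_eq_zero hd)
  have hstar : legendreStar u x = t := by
    rw [legendreStar_eq, hdu, smul_apply, innerSL_apply_apply, smul_eq_mul]
    linarith
  refine ⟨x, hxΩ, ext_inner_right ℝ fun y => ?_⟩
  rw [inner_polarMap, hstar, hdu, smul_apply, innerSL_apply_apply, smul_eq_mul,
    inv_mul_cancel_left₀ htpos.ne']

/-! ### Size of the polar body -/

lemma convex_polarBody (Ω : Set (Euc n)) : Convex ℝ (polarBody Ω) := by
  intro x hx z hz a b ha hb hab y hy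
  rw [inner_add_left, real_inner_smul_left, real_inner_smul_left]
  have := hx y hy
  have := hz y hy
  nlinarith

lemma isBounded_polarBody (hΩ : IsOpen Ω) (h0 : (0 : Euc n) ∈ Ω) :
    Bornology.IsBounded (polarBody Ω) := by
  obtain ⟨r, hr, hball⟩ := Metric.nhds_basis_closedBall.mem_iff.1 (hΩ.mem_nhds h0)
  refine (Metric.isBounded_closedBall (x := (0 : Euc n)) (r := r⁻¹)).subset fun x hx => ?_
  rw [mem_closedBall_zero_iff]
  rcases eq_or_ne x 0 with rfl | hx0
  · simpa using hr.le
  have hxn : 0 < ‖x‖ := norm_pos_iff.2 hx0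
  have h := hx ((r / ‖x‖) • x) (hball (by
    rw [mem_closedBall_zero_iff, norm_smul, Real.norm_of_nonneg (by positivity),
      div_mul_cancel₀ _ hxn.ne']))
  rw [real_inner_smul_right, real_inner_self_eq_norm_sq] at h
  rw [← one_div, le_div_iff₀ hr]
  calc ‖x‖ * r = r / ‖x‖ * ‖x‖ ^ 2 := by field_simp
    _ ≤ 1 := h

lemma MemC0.volume_image_polarMap (hn : 1 ≤ n) (hu : MemC0 Ω u)
    (hΩ : IsSmoothStrictlyConvexDomain Ω) (h0 : (0 : Euc n) ∈ Ω) :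
    volume (polarMap u '' Ω) = volume (polarBody Ω) := by
  refine le_antisymm (measure_mono ?_) ?_
  · rintro _ ⟨x, hx, rfl⟩ y hy
    exact (hu.inner_polarMap_lt_one hn hΩ h0 hx hy).le
  · rw [← measure_interior_of_null_frontier ((convex_polarBody Ω).addHaar_frontier volume)]
    exact measure_mono (hu.interior_polarBody_subset hn hΩ h0)

/-- The derivative of the gradient, as a linear map. -/
noncomputable def hessianMap (u : Euc n → ℝ) (x : Euc n) : Euc n →L[ℝ] Euc n :=
  LinearMap.toContinuousLinearMap
    { toFun := fun v => (InnerProductSpace.toDual ℝ (Euc n)).symm (fderiv ℝ (fderiv ℝ u) x v)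
      map_add' := by simp
      map_smul' := by simp }

lemma inner_hessianMap (u : Euc n → ℝ) (x v w : Euc n) :
    inner ℝ (hessianMap u x v) w = fderiv ℝ (fderiv ℝ u) x v w :=
  InnerProductSpace.toDual_symm_apply

lemma hasFDerivAt_gradient {x : Euc n} (h : DifferentiableAt ℝ (fderiv ℝ u) x) :
    HasFDerivAt (gradient u) (hessianMap u x) x := by
  let T : (Euc n →L[ℝ] ℝ) →L[ℝ] Euc n := LinearMap.toContinuousLinearMap
    { toFun := fun v => (InnerProductSpace.toDual ℝ (Euc n)).symm v
      map_add' := by simp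
      map_smul' := by simp }
  exact T.hasFDerivAt.comp x h.hasFDerivAt

lemma det_hessianMap (u : Euc n → ℝ) (x : Euc n) :
    (hessianMap u x).det = (hessian u x).det := by
  rw [ContinuousLinearMap.det,
    ← LinearMap.det_toMatrix (EuclideanSpace.basisFun (Fin n) ℝ).toBasis, ← Matrix.det_transpose]
  congr 1
  ext i j
  rw [Matrix.transpose_apply, LinearMap.toMatrix_apply, hessian, Matrix.of_apply,
    ← inner_hessianMap]
  simp [EuclideanSpace.inner_single_right]

/-- The first-order terms cancel, leaving only D²u paired with x. -/
lemma hasFDerivAt_legendreStar {x : Euc n} (h : DifferentiableAt ℝ u x)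
    (h2 : DifferentiableAt ℝ (fderiv ℝ u) x) :
    HasFDerivAt (legendreStar u) ((fderiv ℝ (fderiv ℝ u) x).flip x) x := by
  have he : legendreStar u = fun x => fderiv ℝ u x x - u x := funext (legendreStar_eq u)
  rw [he]
  refine ((h2.hasFDerivAt.clm_apply (hasFDerivAt_id x)).sub h.hasFDerivAt).congr_fderiv ?_
  ext v
  simp

/-- The derivative of `polarMap u`, factored as a rank one perturbation of a homothety following
the Hessian. -/
noncomputable def fderivPolarMap (u : Euc n → ℝ) (x : Euc n) : Euc n →L[ℝ] Euc n :=
  (legendreStar u x)⁻¹ • (LinearMap.toContinuousLinearMap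
    (LinearMap.transvection (innerSL ℝ x).toLinearMap
      (-(legendreStar u x)⁻¹ • gradient u x)) ∘L hessianMap u x)

lemma hasFDerivAt_polarMap {x : Euc n} (h : DifferentiableAt ℝ u x)
    (h2 : DifferentiableAt ℝ (fderiv ℝ u) x) (hs : legendreStar u x ≠ 0) :
    HasFDerivAt (polarMap u) (fderivPolarMap u x) x := by
  have hinv := (hasDerivAt_inv hs).comp_hasFDerivAt x (hasFDerivAt_legendreStar h h2)
  refine (hinv.smul (hasFDerivAt_gradient h2)).congr_fderiv ?_
  ext1 v
  have hin : inner ℝ x (hessianMap u x v) = fderiv ℝ (fderiv ℝ u) x v x := by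
    rw [real_inner_comm, inner_hessianMap]
  simp only [fderivPolarMap, add_apply, smul_apply, ContinuousLinearMap.comp_apply,
    ContinuousLinearMap.smulRight_apply, ContinuousLinearMap.flip_apply, Function.comp_apply,
    LinearMap.coe_toContinuousLinearMap', LinearMap.transvection.apply,
    ContinuousLinearMap.coe_coe, innerSL_apply_apply, hin, smul_eq_mul]
  module

/-- The rank one factor has determinant 1 - ⟨x, ∇u⟩/u⋆ = -u/u⋆; the scalar factor supplies the other
n powers of 1/u⋆. -/
lemma det_fderivPolarMap {x : Euc n} (hs : legendreStar u x ≠ 0) :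
    (fderivPolarMap u x).det = polarIntegrand u x := by
  have h1 : inner ℝ x (gradient u x) = legendreStar u x + u x := by
    rw [legendreStar]; ring
  have h2 : (fderivPolarMap u x).det = (legendreStar u x)⁻¹ ^ n *
      ((1 + -(legendreStar u x)⁻¹ * inner ℝ x (gradient u x)) * (hessian u x).det) := by
    rw [← det_hessianMap, ContinuousLinearMap.det, fderivPolarMap,
      ContinuousLinearMap.toLinearMap_smul, LinearMap.det_smul, finrank_euclideanSpace_fin,
      ContinuousLinearMap.toLinearMap_comp, LinearMap.det_comp,
      LinearMap.coe_toContinuousLinearMap, LinearMap.transvection.det]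
    simp [ContinuousLinearMap.det, real_inner_smul_right]
  rw [h2, h1, polarIntegrand, inv_pow]
  field_simp
  ring

lemma MemC0.polarIntegrand_nonneg (hn : 1 ≤ n) (hu : MemC0 Ω u)
    (hΩ : IsSmoothStrictlyConvexDomain Ω) (h0 : (0 : Euc n) ∈ Ω) {x : Euc n} (hx : x ∈ Ω) :
    0 ≤ polarIntegrand u x :=
  div_nonneg (mul_nonneg (neg_nonneg.2 (hu.neg hn hΩ hx).le) (hu.posDef x hx).det_pos.le)
    (pow_nonneg (hu.legendreStar_pos hn hΩ h0 hx).le _)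

lemma MemC0.integrableOn_and_integral_eq (hn : 1 ≤ n) (hu : MemC0 Ω u)
    (hΩ : IsSmoothStrictlyConvexDomain Ω) (h0 : (0 : Euc n) ∈ Ω) :
    IntegrableOn (polarIntegrand u) Ω volume ∧
      ∫ x in Ω, polarIntegrand u x = (volume (polarBody Ω)).toReal := by
  have hmeas := hΩ.isOpen.measurableSet
  have hs : ∀ x ∈ Ω, legendreStar u x ≠ 0 := fun x hx =>
    (hu.legendreStar_pos hn hΩ h0 hx).ne'
  have hderiv : ∀ x ∈ Ω, HasFDerivWithinAt (polarMap u) (fderivPolarMap u x) Ω x := fun x hx =>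
    (hasFDerivAt_polarMap (hu.differentiableAt hΩ hx) (hu.differentiableAt_fderiv hΩ hx)
      (hs x hx)).hasFDerivWithinAt
  have hinj := hu.injOn_polarMap hn hΩ h0
  have hvol := hu.volume_image_polarMap hn hΩ h0
  have heq : Set.EqOn (fun x => |(fderivPolarMap u x).det| • (1 : ℝ)) (polarIntegrand u) Ω := by
    intro x hx
    simp only [smul_eq_mul, mul_one]
    rw [det_fderivPolarMap (hs x hx), abs_of_nonneg (hu.polarIntegrand_nonneg hn hΩ h0 hx)]
  constructor
  · refine IntegrableOn.congr_fun ?_ heq hmeas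
    refine (integrableOn_image_iff_integrableOn_abs_det_fderiv_smul volume hmeas hderiv hinj
      fun _ => (1 : ℝ)).1 (integrableOn_const ?_)
    rw [hvol]
    exact (isBounded_polarBody hΩ.isOpen h0).measure_lt_top.ne
  · rw [← setIntegral_congr_fun hmeas heq,
      ← integral_image_eq_integral_abs_det_fderiv_smul volume hmeas hderiv hinj fun _ => (1 : ℝ)]
    simp [Measure.real, hvol]

end

theorem mainTheorem3 (n : ℕ) (hn : 1 ≤ n) (Ω : Set (Euc n))
    (hΩ : IsSmoothStrictlyConvexDomain Ω) (h0 : (0 : Euc n) ∈ Ω) :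
    volume (polarBody Ω) < ⊤ ∧
    (∀ u : Euc n → ℝ, MemC0 Ω u →
      (∀ x ∈ Ω, 0 < legendreStar u x) ∧
      IntegrableOn (polarIntegrand u) Ω volume ∧
      ∫ x in Ω, polarIntegrand u x = (volume (polarBody Ω)).toReal) ∧
    (∀ u v : Euc n → ℝ, MemC0 Ω u → MemC0 Ω v →
      ∫ x in Ω, polarIntegrand u x = ∫ x in Ω, polarIntegrand v x) :=
  ⟨(isBounded_polarBody hΩ.isOpen h0).measure_lt_top,
    fun _ hu => ⟨fun _ hx => hu.legendreStar_pos hn hΩ h0 hx,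
      hu.integrableOn_and_integral_eq hn hΩ h0⟩,
    fun _ _ hu hv => (hu.integrableOn_and_integral_eq hn hΩ h0).2.trans
      (hv.integrableOn_and_integral_eq hn hΩ h0).2.symm⟩
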